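/- Let $(R,\mathfrak m)$ be a complete Noetherian local (commutative) ring. An \emph{interior operation} $\mathrm i$ on Artinian $R$-modules assigns to every Artinian $R$-module $M$ a submodule $\mathrm i(M)\subseteq M$ such that $\varphi(\mathrm i(M))=\mathrm i(N)$ for every isomorphism $\varphi\colon M\to N$ of Artinian modules, $\mathrm i(L)\subseteq \mathrm i(M)$ whenever $L\subseteq M$, and $\mathrm i(\mathrm i(M))=\mathrm i(M)$. It is called \emph{Nakayama} if, for all Artinian $R$-modules $A\subseteq B$, the inclusion $\mathrm i(A:_B\mathfrak m)\subseteq A$ implies $\mathrm i(A)=\mathrm i(B)$, where $(A:_B\mathfrak m)=\{b\in B : \mathfrak m b\subseteq A\}$. For Artinian $R$-modules $A\subseteq B$, an \emph{$\mathrm i$-expansion of $A$ in $B$} is a submodule $C$ with $A\subseteq C\subseteq B$ and $\mathrm i(A)=\mathrm i(C)$; it is \emph{maximal} if it is not strictly contained in another $\mathrm i$-expansion of $A$ in $B$. Let $A\subseteq B$ be Artinian $R$-modules and let $\mathrm i$ be a Nakayama interior operation on Artinian $R$-modules. Then maximal $\mathrm i$-expansions of $A$ in $B$ exist. In fact, for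 every $\mathrm i$-expansion $C$ of $A$ in $B$ there is a maximal $\mathrm i$-expansion $D$ of $A$ in $B$ with $A\subseteq C\subseteq D\subseteq B$. -/

import Mathlib

universe u v

/-- A submodule selector on the class of Artinian `R`-modules: it assigns to every Artinian module
`M` a submodule of `M`, compatibly with all isomorphisms of Artinian modules. -/
structure ArtinianSubmoduleSelector (R : Type u) [CommRing R] : Type (max u (v + 1)) where
  /-- the selected submodule of an Artinian module -/
  sel : ∀ (M : Type v) [AddCommGroup M] [Module R M] [IsArtinian R M], Submodule R M
  /-- compatibility with isomorphisms -/
  map_sel : ∀ (M N : Type v) [AddCommGroup M] [Module R M] [IsArtinian R M]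
    [AddCommGroup N] [Module R N] [IsArtinian R N] (φ : M ≃ₗ[R] N),
    (sel M).map φ.toLinearMap = sel N

namespace ArtinianSubmoduleSelector

variable {R : Type u} [CommRing R]

/-- `α.on L` is `α(L)` for a submodule `L` of an Artinian module `B`: the selector applied to `L`
as a module in its own right, the result being regarded as a submodule of `B`. -/
def on (α : ArtinianSubmoduleSelector.{u, v} R) {B : Type v} [AddCommGroup B] [Module R B]
    [IsArtinian R B] (L : Submodule R B) : Submodule R B :=
  (α.sel L).map L.subtype

end ArtinianSubmoduleSelector

/-- An interior operation on the class of Artinian `R`-modules: a submodule selector that is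
order-preserving and idempotent. -/
structure ArtinianInterior (R : Type u) [CommRing R] : Type (max u (v + 1)) extends
    ArtinianSubmoduleSelector.{u, v} R where
  /-- `α(L) ⊆ α(M)` for `L ⊆ M` -/
  on_le_sel : ∀ (M : Type v) [AddCommGroup M] [Module R M] [IsArtinian R M] (L : Submodule R M),
    toArtinianSubmoduleSelector.on L ≤ sel M
  /-- `α(α(M)) = α(M)` -/
  on_sel : ∀ (M : Type v) [AddCommGroup M] [Module R M] [IsArtinian R M],
    toArtinianSubmoduleSelector.on (sel M) = sel M

/-- The submodule `(A :_B I) = {b ∈ B | I b ⊆ A}` of `B`. -/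
def moduleColon {R : Type u} [CommRing R] {B : Type v} [AddCommGroup B] [Module R B]
    (A : Submodule R B) (I : Ideal R) : Submodule R B where
  carrier := {b | ∀ r ∈ I, r • b ∈ A}
  add_mem' := fun {a b} ha hb r hr => by
    rw [smul_add]
    exact A.add_mem (ha r hr) (hb r hr)
  zero_mem' := fun r _ => by
    rw [smul_zero]
    exact A.zero_mem
  smul_mem' := fun c x hx r hr => by
    rw [smul_comm]
    exact A.smul_mem c (hx r hr)

namespace ArtinianInterior

variable {R : Type u} [CommRing R]

/-- An interior operation `i` on Artinian modules over a local ring `(R, 𝔪)` is Nakayama if, for all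
Artinian modules `A ⊆ B`, `i(A :_B 𝔪) ⊆ A` implies `i(A) = i(B)`. -/
def IsNakayama [IsLocalRing R] (i : ArtinianInterior.{u, v} R) : Prop :=
  ∀ (B : Type v) [AddCommGroup B] [Module R B] [IsArtinian R B] (A : Submodule R B),
    i.on (moduleColon A (IsLocalRing.maximalIdeal R)) ≤ A → i.on A = i.sel B

/-- `C` is an `i`-expansion of `A` in `B`: `A ⊆ C ⊆ B` and `i(A) = i(C)`. -/
def IsExpansion (i : ArtinianInterior.{u, v} R) {B : Type v} [AddCommGroup B] [Module R B]
    [IsArtinian R B] (A C : Submodule R B) : Prop :=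
  A ≤ C ∧ i.on A = i.on C

/-- `D` is a maximal `i`-expansion of `A` in `B`: it is an `i`-expansion of `A` in `B`, and no
`i`-expansion of `A` in `B` contains it strictly. -/
def IsMaximalExpansion (i : ArtinianInterior.{u, v} R) {B : Type v} [AddCommGroup B] [Module R B]
    [IsArtinian R B] (A D : Submodule R B) : Prop :=
  Maximal (i.IsExpansion A) D

end ArtinianInterior

/-!
By Zorn's lemma it is enough that the union `U` of a chain of `i`-expansions of `A` is again an
`i`-expansion. The quotient `(A :_B 𝔪) / A` is Artinian and killed by `𝔪`, hence a
finite-dimensional vector space over the residue field. So `(A :_U 𝔪) / A` is finitely generated,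
and `(A :_U 𝔪)` already lies in a single member `S` of the chain. Therefore
`i(A :_U 𝔪) ⊆ i(S) = i(A) ⊆ A`, and the Nakayama property gives `i(A) = i(U)`.
-/

section Modules

variable {R M : Type*} [AddCommGroup M]

theorem isNoetherian_iff_isArtinian_of_isTorsionBySet [Ring R] [Module R M] {I : Ideal R}
    [I.IsTwoSided] [IsSemiprimaryRing (R ⧸ I)] (hM : Module.IsTorsionBySet R M I) :
    IsNoetherian R M ↔ IsArtinian R M := by
  let _ : Module (R ⧸ I) M := hM.module
  rw [hM.semilinearMap.isNoetherian_iff_of_bijective Function.bijective_id,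
    hM.semilinearMap.isArtinian_iff_of_bijective Function.bijective_id,
    IsSemiprimaryRing.isNoetherian_iff_isArtinian]

theorem exists_mem_ge_of_fg_map_mkQ [Ring R] [Module R M] {A N : Submodule R M}
    {c : Set (Submodule R M)} (hc : DirectedOn (· ≤ ·) c) (hne : c.Nonempty)
    (hA : ∀ S ∈ c, A ≤ S) (hN : (N.map A.mkQ).FG) (hNc : N ≤ sSup c) : ∃ S ∈ c, N ≤ S := by
  have hdir : DirectedOn (· ≤ ·) (Submodule.map A.mkQ '' c) :=
    directedOn_image.2 (hc.mono fun _ _ h => Submodule.map_mono h)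
  have hle : N.map A.mkQ ≤ sSup (Submodule.map A.mkQ '' c) := by
    rw [sSup_image, ← (Submodule.gc_map_comap A.mkQ).l_sSup]
    exact Submodule.map_mono hNc
  obtain ⟨_, ⟨S, hS, rfl⟩, hNS⟩ :=
    (Submodule.fg_iff_compact _).1 hN _ _ (hne.image _) hdir (isLUB_sSup _) hle
  refine ⟨S, hS, ?_⟩
  rwa [Submodule.map_le_iff_le_comap, Submodule.comap_map_mkQ, sup_eq_right.2 (hA S hS)] at hNS

variable [CommRing R] [Module R M]

theorem comap_moduleColon {M' : Type*} [AddCommGroup M'] [Module R M'] (f : M' →ₗ[R] M)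
    (A : Submodule R M) (I : Ideal R) :
    (moduleColon A I).comap f = moduleColon (A.comap f) I := by
  ext x
  exact forall₂_congr fun r _ => by rw [Submodule.mem_comap, map_smul]

theorem isNoetherian_map_mkQ_moduleColon (A : Submodule R M) [IsArtinian R (M ⧸ A)] (I : Ideal R)
    [IsSemiprimaryRing (R ⧸ I)] : IsNoetherian R ((moduleColon A I).map A.mkQ) := by
  have htorsion : Module.IsTorsionBySet R ((moduleColon A I).map A.mkQ) I := by
    rintro ⟨_, b, hb, rfl⟩ ⟨r, hr⟩
    exact Subtype.ext ((Submodule.Quotient.mk_eq_zero A).2 (hb r hr))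
  exact (isNoetherian_iff_isArtinian_of_isTorsionBySet htorsion).2 inferInstance

end Modules

namespace ArtinianSubmoduleSelector

variable {R : Type u} [CommRing R] (α : ArtinianSubmoduleSelector.{u, v} R)
  {B : Type v} [AddCommGroup B] [Module R B] [IsArtinian R B]

theorem on_le (L : Submodule R B) : α.on L ≤ L :=
  Submodule.map_subtype_le _ _

theorem map_on {E : Type v} [AddCommGroup E] [Module R E] [IsArtinian R E] {f : E →ₗ[R] B}
    (hf : Function.Injective f) (L : Submodule R E) : (α.on L).map f = α.on (L.map f) := by
  unfold on
  rw [← α.map_sel L (L.map f) (Submodule.equivMapOfInjective f hf L), ← Submodule.map_comp,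
    ← Submodule.map_comp]
  rfl

theorem map_subtype_on_comap_subtype (E L : Submodule R B) :
    (α.on (L.comap E.subtype)).map E.subtype = α.on (E ⊓ L) := by
  rw [α.map_on E.injective_subtype, Submodule.map_comap_subtype]

end ArtinianSubmoduleSelector

namespace ArtinianInterior

variable {R : Type u} [CommRing R] {i : ArtinianInterior.{u, v} R}
  {B : Type v} [AddCommGroup B] [Module R B] [IsArtinian R B]

theorem on_mono (i : ArtinianInterior.{u, v} R) {L E : Submodule R B} (h : L ≤ E) :
    i.on L ≤ i.on E := by
  rw [← inf_eq_right.2 h, ← i.map_subtype_on_comap_subtype]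
  exact Submodule.map_mono (i.on_le_sel E _)

variable [IsLocalRing R]

theorem IsNakayama.on_eq_on (hi : i.IsNakayama) {A E : Submodule R B} (hAE : A ≤ E)
    (h : i.on (E ⊓ moduleColon A (IsLocalRing.maximalIdeal R)) ≤ A) : i.on A = i.on E := by
  have hsel : i.on (A.comap E.subtype) = i.sel E := by
    refine hi E _ ?_
    rwa [← comap_moduleColon, ← Submodule.map_le_iff_le_comap, i.map_subtype_on_comap_subtype]
  calc i.on A = (i.on (A.comap E.subtype)).map E.subtype := by
        rw [i.map_subtype_on_comap_subtype, inf_eq_right.2 hAE]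
    _ = i.on E := by rw [hsel, ArtinianSubmoduleSelector.on]

theorem IsNakayama.isExpansion_sSup (hi : i.IsNakayama) {A : Submodule R B}
    {c : Set (Submodule R B)} (hc : DirectedOn (· ≤ ·) c) (hne : c.Nonempty)
    (hexp : ∀ S ∈ c, i.IsExpansion A S) : i.IsExpansion A (sSup c) := by
  let trace := sSup c ⊓ moduleColon A (IsLocalRing.maximalIdeal R)
  have hfg : (trace.map A.mkQ).FG :=
    have : IsSemiprimaryRing (R ⧸ IsLocalRing.maximalIdeal R) :=
      inferInstanceAs (IsSemiprimaryRing (IsLocalRing.ResidueField R))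
    isNoetherian_submodule.1 (isNoetherian_map_mkQ_moduleColon A (IsLocalRing.maximalIdeal R)) _
      (Submodule.map_mono inf_le_right)
  obtain ⟨S, hS, htrace⟩ : ∃ S ∈ c, trace ≤ S :=
    exists_mem_ge_of_fg_map_mkQ hc hne (fun S hS => (hexp S hS).1) hfg inf_le_left
  have hA : A ≤ sSup c := (hexp S hS).1.trans (le_sSup hS)
  refine ⟨hA, hi.on_eq_on hA ?_⟩
  calc i.on trace ≤ i.on S := i.on_mono htrace
    _ = i.on A := (hexp S hS).2.symm
    _ ≤ A := i.on_le A

theorem IsNakayama.exists_isMaximalExpansion_ge (hi : i.IsNakayama) {A C : Submodule R B}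
    (hC : i.IsExpansion A C) : ∃ D : Submodule R B, i.IsMaximalExpansion A D ∧ C ≤ D := by
  obtain ⟨D, hCD, hD⟩ := zorn_le_nonempty₀ {D | i.IsExpansion A D}
    (fun c hexp hc S hS =>
      ⟨sSup c, hi.isExpansion_sSup hc.directedOn ⟨S, hS⟩ hexp, fun _ => le_sSup⟩) C hC
  exact ⟨D, hD, hCD⟩

end ArtinianInterior

theorem mainTheorem4_general {R : Type u} [CommRing R] [IsLocalRing R]
    (i : ArtinianInterior.{u, v} R) (hi : i.IsNakayama)
    {B : Type v} [AddCommGroup B] [Module R B] [IsArtinian R B] (A : Submodule R B) :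
    (∃ D : Submodule R B, i.IsMaximalExpansion A D) ∧
      ∀ C : Submodule R B, i.IsExpansion A C →
        ∃ D : Submodule R B, i.IsMaximalExpansion A D ∧ C ≤ D := by
  have hA : i.IsExpansion A A := ⟨le_rfl, rfl⟩
  obtain ⟨D, hD, -⟩ := hi.exists_isMaximalExpansion_ge hA
  exact ⟨⟨D, hD⟩, fun _ hC => hi.exists_isMaximalExpansion_ge hC⟩

theorem mainTheorem4 {R : Type u} [CommRing R] [IsLocalRing R] [IsNoetherianRing R]
    [IsAdicComplete (IsLocalRing.maximalIdeal R) R]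
    (i : ArtinianInterior.{u, v} R) (hi : i.IsNakayama)
    {B : Type v} [AddCommGroup B] [Module R B] [IsArtinian R B] (A : Submodule R B) :
    (∃ D : Submodule R B, i.IsMaximalExpansion A D) ∧
      ∀ C : Submodule R B, i.IsExpansion A C →
        ∃ D : Submodule R B, i.IsMaximalExpansion A D ∧ C ≤ D :=
  mainTheorem4_general i hi A
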